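/- Let $g\in L^\infty[-1/2,1/2]$ be real-valued and not a.e. equal to $0$, put $e_n(x)=e^{2\pi i n x}$, and let $$\mathcal F(g)=\{e_n : n\in\mathbb Z,\ n\ge 0\}\cup\{g\,e_n : n\in\mathbb Z,\ n<0\}\subset L^2[-1/2,1/2].$$ Write $\phi_n=e_n$ for $n\ge 0$ and $\phi_n=g\,e_n$ for $n<0$. Say that $\mathcal F(g)$ is complete if the only $f\in L^2[-1/2,1/2]$ with $\langle f,\phi_n\rangle=0$ for all $n\in\mathbb Z$ is $f=0$; that it is a frame if there are constants $0<A\le B<\infty$ with $A\|f\|^2\le\sum_{n\in\mathbb Z}|\langle f,\phi_n\rangle|^2\le B\|f\|^2$ for all $f\in L^2[-1/2,1/2]$; and that it is a Riesz basis if it is a frame and every $f\in L^2[-1/2,1/2]$ has a unique expansion $f=\sum_{n\in\mathbb Z}c_n\phi_n$ with complex coefficients $c_n$ (unconditional convergence in $L^2$). Then: 1. $\mathcal F(g)$ is complete. 2. The following are equivalent: (a) $\mathcal F(g)$ is a Riesz basis; (b) $\mathcal F(g)$ is a frame; (c) $0\notin[\operatorname{ess\,inf} g,\operatorname{ess\,sup}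 g]$. -/

import Mathlib

open MeasureTheory
open scoped ENNReal

noncomputable section

namespace WindowedExp

section Hilbert

variable {ι H : Type*} [NormedAddCommGroup H] [InnerProductSpace ℂ H]

/-- The only vector orthogonal to all `φ i` is zero. -/
def IsCompleteSystem (φ : ι → H) : Prop :=
  ∀ f : H, (∀ i, inner ℂ (φ i) f = 0) → f = 0

/-- There are `0 < A ≤ B < ∞` with `A ‖f‖² ≤ ∑ |⟨f, φ i⟩|² ≤ B ‖f‖²` for all `f`. -/
def IsFrame (φ : ι → H) : Prop :=
  ∃ A B : ℝ, 0 < A ∧ A ≤ B ∧ ∀ f : H,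
    Summable (fun i => ‖inner ℂ (φ i) f‖ ^ 2) ∧
    A * ‖f‖ ^ 2 ≤ ∑' i, ‖inner ℂ (φ i) f‖ ^ 2 ∧
    ∑' i, ‖inner ℂ (φ i) f‖ ^ 2 ≤ B * ‖f‖ ^ 2

/-- A frame such that every `f` has a unique expansion `f = ∑ c i • φ i`. -/
def IsRieszBasis (φ : ι → H) : Prop :=
  IsFrame φ ∧ ∀ f : H, ∃! c : ι → ℂ, HasSum (fun i => c i • φ i) f

end Hilbert

/-- Lebesgue measure on `[-1/2, 1/2]`. -/
abbrev μI : Measure ℝ := volume.restrict (Set.Icc (-1 / 2 : ℝ) (1 / 2))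

/-- The exponential `x ↦ e^{2 π i n x}`. -/
def e (n : ℤ) (x : ℝ) : ℂ := Complex.exp (2 * Real.pi * Complex.I * n * x)

theorem norm_e (n : ℤ) (x : ℝ) : ‖e n x‖ = 1 := by
  have h : (2 * Real.pi * Complex.I * n * x : ℂ) = ((2 * Real.pi * n * x : ℝ) : ℂ) * Complex.I := by
    push_cast; ring
  rw [e, h, Complex.norm_exp_ofReal_mul_I]

theorem continuous_e (n : ℤ) : Continuous (e n) := by
  unfold e; fun_prop

theorem memLp_e (n : ℤ) (p : ℝ≥0∞) : MemLp (e n) p μI :=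
  MemLp.of_bound (continuous_e n).aestronglyMeasurable 1 (ae_of_all _ fun x => (norm_e n x).le)

theorem memLp_mul_e {g : ℝ → ℂ} (hg : MemLp g 2 μI) (n : ℤ) :
    MemLp (fun x => g x * e n x) 2 μI :=
  hg.of_le (hg.1.mul (continuous_e n).aestronglyMeasurable)
    (ae_of_all _ fun x => by rw [norm_mul, norm_e, mul_one])

/-- The system `{e_n : n ≥ 0} ∪ {g e_n : n < 0}` in `L²[-1/2, 1/2]`, indexed by `n ∈ ℤ`. -/
def system (g : ℝ → ℂ) (hg : MemLp g 2 μI) (n : ℤ) : Lp ℂ 2 μI :=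
  if 0 ≤ n then (memLp_e n 2).toLp (e n) else (memLp_mul_e hg n).toLp (fun x => g x * e n x)

theorem memLp_ofReal {g : ℝ → ℝ} (hg : MemLp g ∞ μI) : MemLp (fun x => (g x : ℂ)) 2 μI :=
  (hg.ofReal (K := ℂ)).mono_exponent le_top

end WindowedExp

end

/-!
Let `P` be the projection of `L²[-1/2, 1/2]` onto the negative frequencies. The system is the image
of the orthonormal basis `e_n` under `S = (1 - P) + g P`, and `S*` restricted to the range of `P` is
the self-adjoint Toeplitz operator `T_g = P g P`. The system is a frame iff `S*` is bounded below,
which makes `T_g` bounded below and hence invertible; and if `T_g` is invertible then so is `S`, so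
that the system is a Riesz basis. It remains to know the kernel and the spectrum of `T_g`.

If `v` has only negative frequencies and `T_g v` is orthogonal to `e_n v` for all `n < 0`, then the
real function `g |v|²` has no negative Fourier coefficients, hence no nonzero ones besides its mean,
and is constant. For `T_g v = 0` the constant is `0`. If `T_g` is invertible, solving
`T_g v = e_{-1}` shows that `g` does not change sign; applied to `g - t` this puts every `t`
strictly between `ess inf g` and `ess sup g` into the spectrum (the Hartman–Wintner theorem).

Both conclusions use the theorem of F. and M. Riesz that a nonzero `v` with only negative
frequencies vanishes almost nowhere. The projection of `v` to the closed span `N` of all `e_n v`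
with `n < 0` vanishes wherever `v` does, while its difference with `v` has constant modulus because
`N` is invariant under `e_{-1}`. This difference is not `0`, since the greatest frequency of `v`
does not occur in `N`.
-/

noncomputable section

namespace WindowedExp

section FourierUniqueness

open Filter Topology BoundedContinuousFunction
open scoped NNReal

theorem ae_eq_zero_of_forall_integral_boundedContinuous_smul_eq_zero {X E : Type*}
    [TopologicalSpace X] [HasOuterApproxClosed X] [MeasurableSpace X] [BorelSpace X]
    [NormedAddCommGroup E] [NormedSpace ℝ E] [CompleteSpace E] {μ : Measure X} {f : X → E}
    (hf : Integrable f μ) (h : ∀ ψ : X →ᵇ ℝ≥0, ∫ x, ψ x • f x ∂μ = 0) : f =ᵐ[μ] 0 := by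
  refine ae_eq_zero_of_forall_setIntegral_isClosed_eq_zero hf fun s hs => ?_
  have hlim : Tendsto (fun n => ∫ x, hs.apprSeq n x • f x ∂μ) atTop
      (𝓝 (∫ x, s.indicator (fun _ => (1 : ℝ≥0)) x • f x ∂μ)) := by
    refine tendsto_integral_of_dominated_convergence (fun x => ‖f x‖)
      (fun n => (hs.apprSeq n).continuous.aestronglyMeasurable.smul hf.1) hf.norm
      (fun n => ae_of_all _ fun x => ?_) (ae_of_all _ fun x => ?_)
    · rw [NNReal.smul_def, norm_smul, Real.norm_of_nonneg (NNReal.coe_nonneg _)]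
      exact mul_le_of_le_one_left (norm_nonneg _)
        (HasOuterApproxClosed.apprSeq_apply_le_one hs n x)
    · exact ((tendsto_pi_nhds.1 (HasOuterApproxClosed.tendsto_apprSeq hs)) x).smul_const _
  simp only [h, ← Set.indicator_smul_apply_left, one_smul, integral_indicator hs.measurableSet]
    at hlim
  exact (tendsto_nhds_unique tendsto_const_nhds hlim).symm

theorem ae_eq_zero_of_fourierCoeff_eq_zero {T : ℝ} [Fact (0 < T)] {E : Type*}
    [NormedAddCommGroup E] [NormedSpace ℂ E] [CompleteSpace E] {f : AddCircle T → E}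
    (hf : Integrable f AddCircle.haarAddCircle) (h : ∀ n, fourierCoeff f n = 0) :
    f =ᵐ[AddCircle.haarAddCircle] 0 := by
  let Λ : C(AddCircle T, ℂ) →L[ℂ] E :=
    ((ContinuousLinearMap.lsmul ℂ ℂ).lpPairing AddCircle.haarAddCircle ∞ 1).flip (hf.toL1 f) ∘L
      ContinuousMap.toLp ∞ AddCircle.haarAddCircle ℂ
  have hΛ (ψ : C(AddCircle T, ℂ)) : Λ ψ = ∫ t, ψ t • f t ∂AddCircle.haarAddCircle := by
    rw [ContinuousLinearMap.comp_apply, ContinuousLinearMap.flip_apply,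
      ContinuousLinearMap.lpPairing_eq_integral]
    refine integral_congr_ae ?_
    filter_upwards [ContinuousMap.coeFn_toLp (p := ∞) (𝕜 := ℂ) AddCircle.haarAddCircle ψ,
      hf.coeFn_toL1] with t hψ hft
    rw [hψ, hft, ContinuousLinearMap.lsmul_apply]
  have hker : Λ.ker = ⊤ := by
    rw [eq_top_iff, ← span_fourier_closure_eq_top]
    refine Submodule.topologicalClosure_minimal _ (Submodule.span_le.2 ?_) Λ.isClosed_ker
    rintro _ ⟨n, rfl⟩
    rw [SetLike.mem_coe, LinearMap.mem_ker, ContinuousLinearMap.coe_coe, hΛ, ← h (-n),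
      fourierCoeff, neg_neg]
  let _ : NormedSpace ℝ E := NormedSpace.restrictScalars ℝ ℂ E
  refine ae_eq_zero_of_forall_integral_boundedContinuous_smul_eq_zero hf fun ψ => ?_
  rw [← show Λ ⟨fun t => ((ψ t : ℝ) : ℂ), by fun_prop⟩ = 0 from
    LinearMap.mem_ker.1 (hker ▸ Submodule.mem_top), hΛ]
  simp only [ContinuousMap.coe_mk, Complex.coe_smul, NNReal.smul_def]

theorem ae_eq_zero_of_fourierCoeffOn_eq_zero {a b : ℝ} (hab : a < b) {f : ℝ → ℂ}
    (hf : IntegrableOn f (Set.Ioc a b)) (h : ∀ n, fourierCoeffOn hab f n = 0) :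
    f =ᵐ[volume.restrict (Set.Ioc a b)] 0 := by
  have := Fact.mk (sub_pos.2 hab)
  have hb : a + (b - a) = b := add_sub_cancel a b
  have hlift : Integrable (AddCircle.liftIoc (b - a) a f) AddCircle.haarAddCircle := by
    rw [← hb] at hf
    exact memLp_one_iff_integrable.1 (memLp_one_iff_integrable.2 hf).memLp_liftIoc.haarAddCircle
  have hzero : AddCircle.liftIoc (b - a) a f =ᵐ[volume] 0 := by
    rw [AddCircle.volume_eq_smul_haarAddCircle]
    exact Measure.ae_smul_measure (ae_eq_zero_of_fourierCoeff_eq_zero hlift h) _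
  have hpull := (AddCircle.measurePreserving_mk (b - a) a).quasiMeasurePreserving.ae hzero
  rw [hb] at hpull
  filter_upwards [hpull, ae_restrict_mem measurableSet_Ioc] with x hx hmem
  rwa [AddCircle.liftIoc_coe_apply (by rwa [hb])] at hx

end FourierUniqueness

section Exponentials

theorem conj_e (n : ℤ) (x : ℝ) : starRingEnd ℂ (e n x) = e (-n) x := by
  simp [e, ← Complex.exp_conj, Complex.conj_ofNat]

theorem e_mul_e (m n : ℤ) (x : ℝ) : e m x * e n x = e (m + n) x := by
  simp only [e, ← Complex.exp_add]
  congr 1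
  push_cast
  ring

theorem e_zero (x : ℝ) : e 0 x = 1 := by simp [e]

theorem integral_e (n : ℤ) : ∫ x, e n x ∂μI = if n = 0 then 1 else 0 := by
  rw [integral_Icc_eq_integral_Ioc, ← intervalIntegral.integral_of_le (by norm_num)]
  split_ifs with hn
  · subst hn
    simp only [e_zero, intervalIntegral.integral_const]
    norm_num
  · have hc : (2 * Real.pi * Complex.I * n : ℂ) ≠ 0 := by
      simp [Real.pi_ne_zero, hn]
    have hperiod : (2 * Real.pi * Complex.I * n * ((1 / 2 : ℝ) : ℂ)) =
        2 * Real.pi * Complex.I * n * ((-1 / 2 : ℝ) : ℂ) + n * (2 * Real.pi * Complex.I) := by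
      push_cast
      ring
    simp only [e]
    rw [integral_exp_mul_complex hc, hperiod, Complex.exp_periodic.int_mul n, sub_self, zero_div]

theorem ae_eq_zero_of_integral_mul_e_eq_zero {f : ℝ → ℂ} (hf : Integrable f μI)
    (h : ∀ n : ℤ, ∫ x, f x * e n x ∂μI = 0) : f =ᵐ[μI] 0 := by
  have hIoc : μI = volume.restrict (Set.Ioc (-1 / 2 : ℝ) (1 / 2)) :=
    Measure.restrict_congr_set Ioc_ae_eq_Icc.symm
  have hab : (-1 / 2 : ℝ) < 1 / 2 := by norm_num
  rw [hIoc] at hf h ⊢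
  refine ae_eq_zero_of_fourierCoeffOn_eq_zero hab hf fun n => ?_
  rw [fourierCoeffOn_eq_integral, intervalIntegral.integral_of_le hab.le]
  convert smul_zero _
  rw [← h (-n)]
  refine integral_congr_ae (ae_of_all _ fun x => ?_)
  simp only [fourier_coe_apply, e, smul_eq_mul]
  norm_num [mul_comm]

theorem ae_eq_integral_of_integral_mul_e_eq_zero {d : ℝ → ℝ} (hd : Integrable d μI)
    (h : ∀ n : ℤ, 0 < n → ∫ x, (d x : ℂ) * e n x ∂μI = 0) :
    ∀ᵐ x ∂μI, d x = ∫ y, d y ∂μI := by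
  set κ : ℝ := ∫ y, d y ∂μI
  have hneg (n : ℤ) (hn : n < 0) : ∫ x, (d x : ℂ) * e n x ∂μI = 0 := by
    rw [← map_zero (starRingEnd ℂ), ← h (-n) (neg_pos.2 hn), ← integral_conj]
    simp only [map_mul, Complex.conj_ofReal, conj_e, neg_neg]
  have hmul {F : ℝ → ℂ} (hF : Integrable F μI) (n : ℤ) : Integrable (fun x => F x * e n x) μI :=
    hF.mul_bdd (c := 1) (continuous_e n).aestronglyMeasurable
      (ae_of_all _ fun x => (norm_e n x).le)
  have hdC : Integrable (fun x => (d x : ℂ)) μI := hd.ofReal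
  have hzero : (fun x => (d x : ℂ) - κ) =ᵐ[μI] 0 := by
    refine ae_eq_zero_of_integral_mul_e_eq_zero (hdC.sub (integrable_const _)) fun n => ?_
    simp only [sub_mul]
    rw [integral_sub (hmul hdC n) (hmul (integrable_const _) n), integral_const_mul,
      integral_e]
    rcases lt_trichotomy n 0 with hn | rfl | hn
    · rw [hneg n hn, if_neg hn.ne, mul_zero, sub_zero]
    · simp only [e_zero, mul_one, if_true, integral_complex_ofReal, κ, sub_self]
    · rw [h n hn, if_neg hn.ne', mul_zero, sub_zero]
  filter_upwards [hzero] with x hx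
  exact_mod_cast sub_eq_zero.1 hx

end Exponentials

section HilbertSpace

open scoped NNReal

variable {𝕜 ι H : Type*} [RCLike 𝕜] [NormedAddCommGroup H] [InnerProductSpace 𝕜 H]

theorem eq_inner_of_hasSum_smul {b : ι → H} (hb : Orthonormal 𝕜 b) {c : ι → 𝕜} {f : H}
    (hc : HasSum (fun i => c i • b i) f) (i : ι) : c i = inner 𝕜 (b i) f := by
  classical
  have hcoeff := hc.mapL (innerSL 𝕜 (b i))
  simp only [innerSL_apply_apply, inner_smul_right, orthonormal_iff_ite.1 hb, mul_ite, mul_one,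
    mul_zero] at hcoeff
  have hsingle : HasSum (fun j => if i = j then c j else 0) (c i) := by
    simpa using hasSum_single (f := fun j => if i = j then c j else 0) i
      fun j hj => if_neg hj.symm
  exact hsingle.unique hcoeff

theorem isUnit_of_isStarNormal_of_antilipschitzWith [CompleteSpace H] {T : H →L[𝕜] H}
    (hT : IsStarNormal T) {C : ℝ≥0} (hanti : AntilipschitzWith C T) : IsUnit T := by
  rw [ContinuousLinearMap.isUnit_iff_bijective,
    ContinuousLinearMap.bijective_iff_dense_range_and_antilipschitz]
  refine ⟨?_, C, hanti⟩
  rw [Submodule.topologicalClosure_eq_top_iff, ContinuousLinearMap.IsStarNormal.orthogonal_range hT]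
  exact LinearMap.ker_eq_bot.2 hanti.injective

theorem hasSum_norm_sq_inner_map [CompleteSpace H] (b : HilbertBasis ι 𝕜 H)
    (S : H →L[𝕜] H) (f : H) :
    HasSum (fun i => ‖inner 𝕜 (S (b i)) f‖ ^ 2) (‖S.adjoint f‖ ^ 2) := by
  have hparseval := b.hasSum_inner_mul_inner (S.adjoint f) (S.adjoint f)
  have hterm (i : ι) : inner 𝕜 (S.adjoint f) (b i) * inner 𝕜 (b i) (S.adjoint f) =
      ((‖inner 𝕜 (S (b i)) f‖ ^ 2 : ℝ) : 𝕜) := by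
    rw [ContinuousLinearMap.adjoint_inner_right, ContinuousLinearMap.adjoint_inner_left,
      ← inner_conj_symm f, RCLike.conj_mul, RCLike.ofReal_pow]
  simp only [hterm, inner_self_eq_norm_sq_to_K, ← RCLike.ofReal_pow] at hparseval
  exact (RCLike.hasSum_ofReal 𝕜).1 hparseval

theorem adjoint_eq_zero_of_inner_map_eq_zero [CompleteSpace H] (b : HilbertBasis ι 𝕜 H)
    {S : H →L[𝕜] H} {f : H} (h : ∀ i, inner 𝕜 (S (b i)) f = 0) : S.adjoint f = 0 := by
  have hsum := hasSum_norm_sq_inner_map b S f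
  simp only [h, norm_zero, ne_eq, OfNat.ofNat_ne_zero, not_false_eq_true, zero_pow] at hsum
  simpa using hsum.unique hasSum_zero

section Compression

variable (K : Submodule 𝕜 H) [CompleteSpace K] (M : H →L[𝕜] H)

/-- The compression `P_K M|_K` of an operator `M` to the closed subspace `K`. -/
def compression : K →L[𝕜] K :=
  K.orthogonalProjectionOnto ∘L M ∘L K.subtypeL

/-- The operator that acts as `M` on `K` and as the identity on `Kᗮ`. -/
def blockOp : H →L[𝕜] H :=
  1 - K.starProjection + M ∘L K.starProjection

variable {K M}

theorem inner_compression_right (u v : K) :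
    inner 𝕜 u (compression K M v) = inner 𝕜 (u : H) (M v) :=
  Submodule.inner_orthogonalProjectionOnto_eq_of_mem_left u _

theorem isSelfAdjoint_compression [CompleteSpace H] (hM : IsSelfAdjoint M) :
    IsSelfAdjoint (compression K M) := by
  rw [compression, ← K.adjoint_subtypeL]
  exact hM.adjoint_conj K.subtypeL

theorem compression_sub (N : H →L[𝕜] H) :
    compression K (M - N) = compression K M - compression K N := by
  ext v : 1
  simp only [compression, ContinuousLinearMap.comp_apply, sub_apply, map_sub]

theorem compression_algebraMap (c : 𝕜) :
    compression K (algebraMap 𝕜 (H →L[𝕜] H) c) = algebraMap 𝕜 (K →L[𝕜] K) c := by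
  ext v : 1
  simp [compression, ContinuousLinearMap.algebraMap_apply]

theorem blockOp_apply_of_mem {f : H} (hf : f ∈ K) : blockOp K M f = M f := by
  simp [blockOp, Submodule.starProjection_eq_self_iff.2 hf]

theorem blockOp_apply_of_mem_orthogonal {f : H} (hf : f ∈ Kᗮ) : blockOp K M f = f := by
  simp [blockOp, K.starProjection_apply_eq_zero_iff.2 hf]

theorem adjoint_blockOp_coe [CompleteSpace H] (v : K) :
    (blockOp K M).adjoint (v : H) = compression K M.adjoint v := by
  refine ext_inner_left 𝕜 fun f => ?_
  have horth : inner 𝕜 (f - K.starProjection f) (v : H) = 0 :=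
    K.starProjection_inner_eq_zero f v v.2
  calc inner 𝕜 f ((blockOp K M).adjoint (v : H))
      = inner 𝕜 (f - K.starProjection f + M (K.starProjection f)) (v : H) := by
        rw [ContinuousLinearMap.adjoint_inner_right]
        rfl
    _ = inner 𝕜 (K.starProjection f) (M.adjoint (v : H)) := by
        rw [inner_add_left, horth, zero_add, ContinuousLinearMap.adjoint_inner_right]
    _ = inner 𝕜 f (compression K M.adjoint v : H) := K.inner_starProjection_left_eq_right f _

theorem isUnit_blockOp [CompleteSpace H] (h : IsUnit (compression K M)) : IsUnit (blockOp K M) := by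
  rw [ContinuousLinearMap.isUnit_iff_bijective] at h ⊢
  set Q := K.orthogonalProjectionOnto
  have hS (f : H) : blockOp K M f = f - Q f + M (Q f) := rfl
  have hQ (v : K) : Q (v : H) = v := K.orthogonalProjectionOnto_mem_subspace_eq_self v
  have hQS (f : H) : Q (blockOp K M f) = compression K M (Q f) := by
    rw [hS, map_add, map_sub, hQ, sub_self, zero_add]
    rfl
  constructor
  · rw [injective_iff_map_eq_zero]
    intro f hf
    have hQf : Q f = 0 := h.1 (by rw [← hQS, hf, map_zero, map_zero])
    simpa [hS, hQf] using hf
  · intro f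
    obtain ⟨v, hv⟩ := h.2 (Q f)
    have hQg : Q (f - M v + v) = v := by
      rw [map_add, map_sub, hQ, ← hv]
      exact add_eq_right.2 (sub_self _)
    refine ⟨f - M v + v, ?_⟩
    rw [hS, hQg]
    abel

end Compression

end HilbertSpace

section Spectrum

theorem spectrum_eq_Icc_of_Ioo_subset {H : Type*} [NormedAddCommGroup H] [InnerProductSpace ℂ H]
    [CompleteSpace H] [Nontrivial H] {T : H →L[ℂ] H}
    (hT : IsSelfAdjoint T) {a b : ℝ} (hIoo : Set.Ioo a b ⊆ spectrum ℝ T)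
    (hIcc : spectrum ℝ T ⊆ Set.Icc a b) : spectrum ℝ T = Set.Icc a b := by
  refine hIcc.antisymm ?_
  rcases lt_or_ge a b with hab | hba
  · rw [← closure_Ioo hab.ne]
    exact closure_minimal hIoo (spectrum.isClosed T)
  · obtain ⟨t, ht⟩ := ContinuousFunctionalCalculus.spectrum_nonempty (R := ℝ) T hT
    intro y hy
    rwa [Set.subsingleton_Icc_of_ge hba hy (hIcc ht)]

end Spectrum

section Frames

variable {ι H : Type*} [NormedAddCommGroup H] [InnerProductSpace ℂ H] [CompleteSpace H]
  (b : HilbertBasis ι ℂ H)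

theorem isFrame_map_hilbertBasis_iff {S : H →L[ℂ] H} :
    IsFrame (fun i => S (b i)) ↔ ∃ K, AntilipschitzWith K S.adjoint := by
  simp only [IsFrame, (hasSum_norm_sq_inner_map b S _).tsum_eq,
    (hasSum_norm_sq_inner_map b S _).summable, true_and]
  rw [antilipschitzWith_iff_exists_mul_le_norm]
  constructor
  · rintro ⟨A, B, hA, -, hAB⟩
    refine ⟨√A, Real.sqrt_pos.2 hA, fun f => le_of_sq_le_sq ?_ (norm_nonneg _)⟩
    rw [mul_pow, Real.sq_sqrt hA.le]
    exact (hAB f).1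
  · rintro ⟨c, hc, hbound⟩
    refine ⟨c ^ 2, max (c ^ 2) (‖S.adjoint‖ ^ 2), pow_pos hc 2, le_max_left _ _, fun f => ⟨?_, ?_⟩⟩
    · rw [← mul_pow]
      exact pow_le_pow_left₀ (by positivity) (hbound f) 2
    · calc ‖S.adjoint f‖ ^ 2 ≤ (‖S.adjoint‖ * ‖f‖) ^ 2 :=
            pow_le_pow_left₀ (norm_nonneg _) (S.adjoint.le_opNorm f) 2
        _ = ‖S.adjoint‖ ^ 2 * ‖f‖ ^ 2 := mul_pow _ _ _
        _ ≤ max (c ^ 2) (‖S.adjoint‖ ^ 2) * ‖f‖ ^ 2 := by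
            gcongr
            exact le_max_right _ _

theorem isRieszBasis_map_hilbertBasis {S : H →L[ℂ] H} (hS : IsUnit S) :
    IsRieszBasis fun i => S (b i) := by
  refine ⟨(isFrame_map_hilbertBasis_iff b).2 (ContinuousLinearMap.antilipschitz_of_isEmbedding _
    (ContinuousLinearMap.isHomeomorph_of_isUnit hS.star).isEmbedding), fun f => ?_⟩
  obtain ⟨R, hSR, hRS⟩ := isUnit_iff_exists.1 hS
  have hSR (f : H) : S (R f) = f := DFunLike.congr_fun hSR f
  have hRS (f : H) : R (S f) = f := DFunLike.congr_fun hRS f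
  refine ⟨fun i => inner ℂ (b i) (R f), ?_, fun c hc => funext fun i => ?_⟩
  · simpa only [map_smul, b.repr_apply_apply, hSR] using (b.hasSum_repr (R f)).mapL S
  · have hcR := hc.mapL R
    simp only [map_smul, hRS] at hcR
    exact eq_inner_of_hasSum_smul b.orthonormal hcR i

variable {K : Submodule ℂ H} [CompleteSpace K] {M : H →L[ℂ] H}

theorem isUnit_compression_of_isFrame_blockOp (hM : IsSelfAdjoint M)
    (h : IsFrame fun i => blockOp K M (b i)) : IsUnit (compression K M) := by
  obtain ⟨C, hC⟩ := (isFrame_map_hilbertBasis_iff b).1 h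
  refine isUnit_of_isStarNormal_of_antilipschitzWith
    (isSelfAdjoint_compression hM).isStarNormal (C := C) fun u v => ?_
  have huv := hC (u : H) (v : H)
  rw [adjoint_blockOp_coe, adjoint_blockOp_coe, hM.adjoint_eq] at huv
  exact huv

theorem isRieszBasis_blockOp_of_isUnit_compression (h : IsUnit (compression K M)) :
    IsRieszBasis fun i => blockOp K M (b i) :=
  isRieszBasis_map_hilbertBasis b (isUnit_blockOp h)

end Frames

section Multiplication

variable {α : Type*} [MeasurableSpace α] {μ : Measure α}

/-- Multiplication by an essentially bounded function, as an operator on `L²`. -/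
def mulOp {h : α → ℂ} (hh : MemLp h ∞ μ) : Lp ℂ 2 μ →L[ℂ] Lp ℂ 2 μ :=
  (ContinuousLinearMap.mul ℂ ℂ).holderL μ ∞ 2 2 hh.toLp

/-- Multiplication by a real-valued essentially bounded function, as an operator on `L²`. -/
abbrev mulReal {r : α → ℝ} (hr : MemLp r ∞ μ) : Lp ℂ 2 μ →L[ℂ] Lp ℂ 2 μ :=
  mulOp (hr.ofReal (K := ℂ))

theorem coeFn_mulOp {h : α → ℂ} (hh : MemLp h ∞ μ) (f : Lp ℂ 2 μ) :
    mulOp hh f =ᵐ[μ] fun x => h x * f x := by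
  filter_upwards [(ContinuousLinearMap.mul ℂ ℂ).coeFn_holder (r := 2) hh.toLp f, hh.coeFn_toLp]
    with x hmul hx
  rw [← hx]
  exact hmul

theorem mulReal_sub {r s : α → ℝ} (hr : MemLp r ∞ μ) (hs : MemLp s ∞ μ) :
    mulReal (hr.sub hs) = mulReal hr - mulReal hs := by
  rw [mulReal, mulOp, mulReal, mulOp, mulReal, mulOp, ← map_sub, ← MemLp.toLp_sub]
  congr 1
  exact MemLp.toLp_congr _ _ (ae_of_all _ fun x => Complex.ofReal_sub _ _)

theorem mulReal_const [IsFiniteMeasure μ] (t : ℝ) :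
    mulReal (memLp_const t : MemLp (fun _ : α => t) ∞ μ) = algebraMap ℝ _ t := by
  ext f
  filter_upwards [coeFn_mulOp ((memLp_const t : MemLp (fun _ : α => t) ∞ μ).ofReal (K := ℂ)) f,
    Lp.coeFn_smul t f] with x hmul hsmul
  rw [hmul, Algebra.algebraMap_eq_smul_one]
  exact (hsmul.trans (Complex.real_smul ..)).symm

theorem isSelfAdjoint_mulReal {r : α → ℝ} (hr : MemLp r ∞ μ) : IsSelfAdjoint (mulReal hr) := by
  rw [ContinuousLinearMap.isSelfAdjoint_iff_isSymmetric]
  intro f g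
  simp only [ContinuousLinearMap.coe_coe, L2.inner_def, RCLike.inner_apply']
  refine integral_congr_ae ?_
  filter_upwards [coeFn_mulOp (hr.ofReal (K := ℂ)) f, coeFn_mulOp (hr.ofReal (K := ℂ)) g]
    with x hf hg
  rw [hf, hg, map_mul, RCLike.conj_ofReal]
  ring

theorem conj_mul_mulReal {r : α → ℝ} (hr : MemLp r ∞ μ) (f : Lp ℂ 2 μ) :
    ∀ᵐ x ∂μ, starRingEnd ℂ (f x) * mulReal hr f x = (r x * ‖f x‖ ^ 2 : ℝ) := by
  filter_upwards [coeFn_mulOp (hr.ofReal (K := ℂ)) f] with x hx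
  rw [hx, Complex.ofReal_mul, Complex.ofReal_pow, ← Complex.conj_mul']
  exact mul_left_comm _ _ _

theorem le_norm_inner_mulReal {r : α → ℝ} (hr : MemLp r ∞ μ) {c : ℝ} (h : ∀ᵐ x ∂μ, c ≤ r x)
    (f : Lp ℂ 2 μ) : c * ‖f‖ ^ 2 ≤ ‖inner ℂ f (mulReal hr f)‖ := by
  have hre (g : Lp ℂ 2 μ) :
      RCLike.re (inner ℂ f g) = ∫ x, RCLike.re (inner ℂ (f x) (g x)) ∂μ := by
    rw [L2.inner_def, integral_re (L2.integrable_inner f g)]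
  refine le_trans ?_ (RCLike.re_le_norm _)
  rw [← inner_self_eq_norm_sq (𝕜 := ℂ), hre, hre, ← integral_const_mul]
  refine integral_mono_ae ((L2.integrable_inner f f).re.const_mul c)
    (L2.integrable_inner f (mulReal hr f)).re ?_
  filter_upwards [h, conj_mul_mulReal hr f] with x hx hmul
  rw [RCLike.inner_apply' _ (mulReal hr f x), hmul, inner_self_eq_norm_sq]
  exact mul_le_mul_of_nonneg_right hx (sq_nonneg _)

end Multiplication

section Modulation

/-- The exponential `e n` as an element of `L²[-1/2, 1/2]`. -/
def expLp (n : ℤ) : Lp ℂ 2 μI := (memLp_e n 2).toLp (e n)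

/-- Multiplication by `e n` on `L²[-1/2, 1/2]`, which shifts all frequencies by `n`. -/
def modulation (n : ℤ) : Lp ℂ 2 μI →L[ℂ] Lp ℂ 2 μI := mulOp (memLp_e n ∞)

theorem coeFn_expLp (n : ℤ) : expLp n =ᵐ[μI] e n := MemLp.coeFn_toLp _

theorem coeFn_modulation (n : ℤ) (f : Lp ℂ 2 μI) :
    modulation n f =ᵐ[μI] fun x => e n x * f x := coeFn_mulOp _ _

theorem modulation_expLp (m n : ℤ) : modulation m (expLp n) = expLp (m + n) := by
  ext1
  filter_upwards [coeFn_modulation m (expLp n), coeFn_expLp n, coeFn_expLp (m + n)]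
    with x hmn hn hadd
  rw [hmn, hn, hadd, e_mul_e]

theorem modulation_modulation (m n : ℤ) (f : Lp ℂ 2 μI) :
    modulation m (modulation n f) = modulation (m + n) f := by
  ext1
  filter_upwards [coeFn_modulation m (modulation n f), coeFn_modulation n f,
    coeFn_modulation (m + n) f] with x hmn hn hadd
  rw [hmn, hn, hadd, ← e_mul_e, mul_assoc]

theorem inner_modulation_left (n : ℤ) (f g : Lp ℂ 2 μI) :
    inner ℂ (modulation n f) g = inner ℂ f (modulation (-n) g) := by
  simp only [L2.inner_def, RCLike.inner_apply']
  refine integral_congr_ae ?_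
  filter_upwards [coeFn_modulation n f, coeFn_modulation (-n) g] with x hf hg
  rw [hf, hg, map_mul, conj_e]
  ring

theorem inner_expLp_modulation (m n : ℤ) (f : Lp ℂ 2 μI) :
    inner ℂ (expLp m) (modulation n f) = inner ℂ (expLp (m - n)) f := by
  rw [← neg_neg n, ← inner_modulation_left, modulation_expLp, neg_neg, neg_add_eq_sub]

theorem inner_expLp (n : ℤ) (f : Lp ℂ 2 μI) :
    inner ℂ (expLp n) f = ∫ x, f x * e (-n) x ∂μI := by
  simp only [L2.inner_def, RCLike.inner_apply]
  refine integral_congr_ae ?_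
  filter_upwards [coeFn_expLp n] with x hx
  rw [hx, conj_e]

theorem orthonormal_expLp : Orthonormal ℂ expLp := by
  rw [orthonormal_iff_ite]
  intro m n
  have hmul : (fun x => expLp n x * e (-m) x) =ᵐ[μI] e (n - m) := by
    filter_upwards [coeFn_expLp n] with x hx
    rw [hx, e_mul_e, sub_eq_add_neg]
  rw [inner_expLp, integral_congr_ae hmul, integral_e]
  exact if_congr (by rw [sub_eq_zero, eq_comm]) rfl rfl

theorem eq_zero_of_inner_expLp_eq_zero {f : Lp ℂ 2 μI}
    (h : ∀ n : ℤ, inner ℂ (expLp n) f = 0) : f = 0 := by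
  rw [Lp.eq_zero_iff_ae_eq_zero]
  refine ae_eq_zero_of_integral_mul_e_eq_zero ((Lp.memLp f).integrable one_le_two) fun n => ?_
  rw [← neg_neg n, ← inner_expLp, h]

/-- The exponentials as a Hilbert basis of `L²[-1/2, 1/2]`. -/
def expBasis : HilbertBasis ℤ ℂ (Lp ℂ 2 μI) :=
  HilbertBasis.mkOfOrthogonalEqBot orthonormal_expLp <| (Submodule.eq_bot_iff _).2 fun _ hf =>
    eq_zero_of_inner_expLp_eq_zero fun n =>
      (Submodule.mem_orthogonal _ _).1 hf _ (Submodule.subset_span ⟨n, rfl⟩)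

theorem expBasis_apply (n : ℤ) : expBasis n = expLp n := by
  rw [expBasis, HilbertBasis.coe_mkOfOrthogonalEqBot]

theorem ae_eq_inner_of_inner_modulation_eq_zero {f g : Lp ℂ 2 μI} {d : ℝ → ℝ}
    (hd : ∀ᵐ x ∂μI, starRingEnd ℂ (f x) * g x = d x)
    (h : ∀ n : ℤ, n < 0 → inner ℂ (modulation n f) g = 0) :
    ∀ᵐ x ∂μI, (d x : ℂ) = inner ℂ f g := by
  have hinner : (fun x => inner ℂ (f x) (g x)) =ᵐ[μI] fun x => (d x : ℂ) := by
    filter_upwards [hd] with x hx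
    rw [RCLike.inner_apply', hx]
  have hint : Integrable d μI := ((L2.integrable_inner f g).congr hinner).re
  have hmean : inner ℂ f g = ((∫ x, d x ∂μI : ℝ) : ℂ) := by
    rw [L2.inner_def, integral_congr_ae hinner, integral_complex_ofReal]
  have hconst := ae_eq_integral_of_integral_mul_e_eq_zero hint fun n hn => by
    rw [← h (-n) (neg_lt_zero.2 hn), L2.inner_def]
    refine integral_congr_ae ?_
    filter_upwards [hd, coeFn_modulation (-n) f] with x hx hmod
    rw [RCLike.inner_apply', hmod, map_mul, conj_e, neg_neg, mul_assoc, hx, mul_comm]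
  filter_upwards [hconst] with x hx
  rw [hmean, ← hx]

end Modulation

section NegativeFrequencies

/-- The functions in `L²[-1/2, 1/2]` all of whose frequencies are negative. -/
def negFreq : Submodule ℂ (Lp ℂ 2 μI) :=
  (Submodule.span ℂ (expLp '' {n | 0 ≤ n}))ᗮ

instance : CompleteSpace negFreq :=
  inferInstanceAs (CompleteSpace (Submodule.span ℂ (expLp '' {n | 0 ≤ n}))ᗮ)

theorem mem_negFreq {f : Lp ℂ 2 μI} :
    f ∈ negFreq ↔ ∀ n : ℤ, 0 ≤ n → inner ℂ (expLp n) f = 0 := by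
  refine ⟨fun hf n hn => (Submodule.mem_orthogonal _ _).1 hf _ (Submodule.subset_span ⟨n, hn, rfl⟩),
    fun h => ?_⟩
  rw [negFreq, Submodule.mem_orthogonal]
  intro u hu
  refine Submodule.span_induction (p := fun u _ => inner ℂ u f = 0) ?_ (inner_zero_left f)
    (fun u v _ _ hu hv => ?_) (fun c u _ hu => ?_) hu
  · rintro _ ⟨n, hn, rfl⟩
    exact h n hn
  · rw [inner_add_left, hu, hv, add_zero]
  · rw [inner_smul_left, hu, mul_zero]

theorem modulation_mem_negFreq {f : Lp ℂ 2 μI} (hf : f ∈ negFreq) {n : ℤ} (hn : n ≤ 0) :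
    modulation n f ∈ negFreq :=
  mem_negFreq.2 fun m hm => by
    rw [inner_expLp_modulation]
    exact mem_negFreq.1 hf _ (by lia)

theorem expLp_mem_negFreq {n : ℤ} (hn : n < 0) : expLp n ∈ negFreq :=
  mem_negFreq.2 fun _ hm => orthonormal_expLp.2 (by lia)

theorem expLp_mem_orthogonal_negFreq {n : ℤ} (hn : 0 ≤ n) : expLp n ∈ negFreqᗮ :=
  Submodule.le_orthogonal_orthogonal _ (Submodule.subset_span ⟨n, hn, rfl⟩)

instance : Nontrivial negFreq :=
  ⟨⟨expLp (-1), expLp_mem_negFreq neg_one_lt_zero⟩, 0, fun h =>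
    orthonormal_expLp.ne_zero (-1) (congrArg Subtype.val h)⟩

theorem exists_greatest_frequency {f : Lp ℂ 2 μI} (hf : f ∈ negFreq) (hf0 : f ≠ 0) :
    ∃ m : ℤ, inner ℂ (expLp m) f ≠ 0 ∧ ∀ n : ℤ, m < n → inner ℂ (expLp n) f = 0 := by
  have hbdd (n : ℤ) (hn : inner ℂ (expLp n) f ≠ 0) : n ≤ 0 := by
    by_contra! hpos
    exact hn (mem_negFreq.1 hf n hpos.le)
  have hex : ∃ m : ℤ, inner ℂ (expLp m) f ≠ 0 := by
    by_contra! h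
    exact hf0 (eq_zero_of_inner_expLp_eq_zero h)
  obtain ⟨m, hm, hmax⟩ := Int.exists_greatest_of_bdd ⟨0, hbdd⟩ hex
  refine ⟨m, hm, fun n hn => ?_⟩
  by_contra h
  exact (hmax n h).not_gt hn

end NegativeFrequencies

section LowerShifts

/-- The smallest closed subspace of `L²[-1/2, 1/2]` containing `e_n f` for all `n < 0`. -/
def lowerShifts (f : Lp ℂ 2 μI) : Submodule ℂ (Lp ℂ 2 μI) :=
  (Submodule.span ℂ ((fun n : ℤ => modulation n f) '' {n | n < 0})).topologicalClosure

theorem isClosed_lowerShifts (f : Lp ℂ 2 μI) : IsClosed (lowerShifts f : Set (Lp ℂ 2 μI)) :=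
  Submodule.isClosed_topologicalClosure _

instance (f : Lp ℂ 2 μI) : CompleteSpace (lowerShifts f) :=
  (isClosed_lowerShifts f).completeSpace_coe

theorem modulation_mem_lowerShifts (f : Lp ℂ 2 μI) {n : ℤ} (hn : n < 0) :
    modulation n f ∈ lowerShifts f :=
  Submodule.le_topologicalClosure _ (Submodule.subset_span ⟨n, hn, rfl⟩)

theorem lowerShifts_le {f : Lp ℂ 2 μI} {M : Submodule ℂ (Lp ℂ 2 μI)}
    (hM : IsClosed (M : Set (Lp ℂ 2 μI))) (h : ∀ n : ℤ, n < 0 → modulation n f ∈ M) :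
    lowerShifts f ≤ M := by
  refine Submodule.topologicalClosure_minimal _ (Submodule.span_le.2 ?_) hM
  rintro _ ⟨n, hn, rfl⟩
  exact h n hn

theorem modulation_mem_lowerShifts_of_mem {f g : Lp ℂ 2 μI} (hg : g ∈ lowerShifts f) {k : ℤ}
    (hk : k < 0) : modulation k g ∈ lowerShifts f := by
  have hle : lowerShifts f ≤ (lowerShifts f).comap (modulation k).toLinearMap := by
    refine lowerShifts_le ((isClosed_lowerShifts f).preimage (modulation k).continuous)
      fun n hn => ?_
    rw [Submodule.mem_comap, ContinuousLinearMap.coe_coe, modulation_modulation]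
    exact modulation_mem_lowerShifts f (add_neg hk hn)
  exact hle hg

theorem notMem_lowerShifts_self {f : Lp ℂ 2 μI} (hf : f ∈ negFreq) (hf0 : f ≠ 0) :
    f ∉ lowerShifts f := by
  obtain ⟨m, hm, hmax⟩ := exists_greatest_frequency hf hf0
  have hle : lowerShifts f ≤ (innerSL ℂ (expLp m)).ker := by
    refine lowerShifts_le (innerSL ℂ (expLp m)).isClosed_ker fun n hn => ?_
    rw [LinearMap.mem_ker, ContinuousLinearMap.coe_coe, innerSL_apply_apply,
      inner_expLp_modulation]
    exact hmax _ (by lia)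
  exact fun hmem => hm (LinearMap.mem_ker.1 (hle hmem))

theorem ae_eq_zero_of_mem_lowerShifts {f g : Lp ℂ 2 μI} (hg : g ∈ lowerShifts f) :
    ∀ᵐ x ∂μI, f x = 0 → g x = 0 := by
  set s : Set ℝ := {x | f x = 0}
  have hs : MeasurableSet s := (Lp.stronglyMeasurable f).measurable (measurableSet_singleton 0)
  set R := LpToLpRestrictCLM ℝ ℂ ℂ μI 2 s
  have hR (h : Lp ℂ 2 μI) : h ∈ R.ker ↔ ∀ᵐ x ∂μI, x ∈ s → h x = 0 := by
    rw [LinearMap.mem_ker, ContinuousLinearMap.coe_coe, Lp.eq_zero_iff_ae_eq_zero,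
      ← ae_restrict_iff' hs]
    exact ⟨(LpToLpRestrictCLM_coeFn ℂ s h).symm.trans, (LpToLpRestrictCLM_coeFn ℂ s h).trans⟩
  have hle : lowerShifts f ≤ R.ker := by
    refine lowerShifts_le R.isClosed_ker fun n _ => (hR _).2 ?_
    filter_upwards [coeFn_modulation n f] with x hx hxs
    rw [hx, hxs, mul_zero]
  exact (hR g).1 (hle hg)

theorem ae_norm_sq_eq_of_orthogonal_lowerShifts {f u : Lp ℂ 2 μI} (hu : u ∈ (lowerShifts f)ᗮ)
    (hfu : f - u ∈ lowerShifts f) : ∀ᵐ x ∂μI, ‖u x‖ ^ 2 = ‖u‖ ^ 2 := by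
  have horth (n : ℤ) (hn : n < 0) : inner ℂ (modulation n u) u = 0 := by
    refine (Submodule.mem_orthogonal _ _).1 hu _ ?_
    rw [← sub_sub_self f u, map_sub]
    exact sub_mem (modulation_mem_lowerShifts f hn) (modulation_mem_lowerShifts_of_mem hfu hn)
  have hsq : ∀ᵐ x ∂μI, starRingEnd ℂ (u x) * u x = (‖u x‖ ^ 2 : ℝ) :=
    ae_of_all _ fun x => by rw [Complex.conj_mul', Complex.ofReal_pow]
  filter_upwards [ae_eq_inner_of_inner_modulation_eq_zero hsq horth] with x hx
  rw [inner_self_eq_norm_sq_to_K] at hx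
  exact Complex.ofReal_injective (hx.trans (Complex.ofReal_pow _ _).symm)

theorem ae_ne_zero_of_mem_negFreq {f : Lp ℂ 2 μI} (hf : f ∈ negFreq) (hf0 : f ≠ 0) :
    ∀ᵐ x ∂μI, f x ≠ 0 := by
  set p := (lowerShifts f).starProjection f
  have hp : p ∈ lowerShifts f := Submodule.starProjection_apply_mem _ f
  have hu0 : f - p ≠ 0 := fun h => notMem_lowerShifts_self hf hf0 (sub_eq_zero.1 h ▸ hp)
  have hconst := ae_norm_sq_eq_of_orthogonal_lowerShifts
    (Submodule.sub_starProjection_mem_orthogonal (K := lowerShifts f) f)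
    (by rwa [sub_sub_cancel])
  filter_upwards [hconst, ae_eq_zero_of_mem_lowerShifts hp, Lp.coeFn_sub f p]
    with x hnorm hpx hsub hfx
  rw [hsub, Pi.sub_apply, hfx, hpx hfx, sub_zero, norm_zero, zero_pow two_ne_zero] at hnorm
  exact hu0 (norm_eq_zero.1 (pow_eq_zero_iff two_ne_zero |>.1 hnorm.symm))

end LowerShifts

section Toeplitz

variable {r s : ℝ → ℝ} (hr : MemLp r ∞ μI) (hs : MemLp s ∞ μI)

/-- The Toeplitz operator with symbol `r`: multiplication by `r` followed by the projection to the
negative frequencies. Up to the reflection `x ↦ -x` and a shift of the frequencies by one, this is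
the classical Toeplitz operator on the Hardy space. -/
def toeplitz : negFreq →L[ℂ] negFreq :=
  compression negFreq (mulReal hr)

theorem inner_toeplitz_right (u v : negFreq) :
    inner ℂ u (toeplitz hr v) = inner ℂ (u : Lp ℂ 2 μI) (mulReal hr v) :=
  inner_compression_right u v

theorem isSelfAdjoint_toeplitz : IsSelfAdjoint (toeplitz hr) :=
  isSelfAdjoint_compression (isSelfAdjoint_mulReal hr)

theorem toeplitz_sub : toeplitz (hr.sub hs) = toeplitz hr - toeplitz hs := by
  rw [toeplitz, mulReal_sub, compression_sub, toeplitz, toeplitz]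

theorem toeplitz_const (t : ℝ) : toeplitz (memLp_const t) = algebraMap ℝ _ t := by
  rw [toeplitz, mulReal_const, IsScalarTower.algebraMap_apply ℝ ℂ, compression_algebraMap,
    ← IsScalarTower.algebraMap_apply]

variable {hr}

theorem ae_mul_norm_sq_eq_inner_toeplitz {v : negFreq}
    (h : ∀ n : ℤ, n < 0 → inner ℂ (modulation n v) (toeplitz hr v : Lp ℂ 2 μI) = 0) :
    ∀ᵐ x ∂μI, ((r x * ‖(v : Lp ℂ 2 μI) x‖ ^ 2 : ℝ) : ℂ) = inner ℂ v (toeplitz hr v) := by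
  rw [inner_toeplitz_right]
  refine ae_eq_inner_of_inner_modulation_eq_zero (conj_mul_mulReal hr v) fun n hn => ?_
  rw [← h n hn]
  exact (inner_toeplitz_right hr ⟨_, modulation_mem_negFreq v.2 hn.le⟩ v).symm

theorem toeplitz_injective (hr0 : ¬ r =ᵐ[μI] 0) : Function.Injective (toeplitz hr) := by
  rw [injective_iff_map_eq_zero]
  intro v hv
  by_contra hv0
  have hzero := ae_mul_norm_sq_eq_inner_toeplitz (hr := hr) (v := v) fun n _ => by
    rw [hv, Submodule.coe_zero, inner_zero_right]
  refine hr0 ?_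
  filter_upwards [hzero, ae_ne_zero_of_mem_negFreq v.2 (by simpa using hv0)] with x hx hvx
  rw [hv, inner_zero_right, Complex.ofReal_eq_zero, mul_eq_zero] at hx
  exact hx.resolve_right (by positivity)

theorem ae_nonneg_or_ae_nonpos_of_isUnit_toeplitz (h : IsUnit (toeplitz hr)) :
    (∀ᵐ x ∂μI, 0 ≤ r x) ∨ ∀ᵐ x ∂μI, r x ≤ 0 := by
  set w : negFreq := ⟨expLp (-1), expLp_mem_negFreq neg_one_lt_zero⟩
  obtain ⟨v, hv⟩ := (ContinuousLinearMap.isUnit_iff_bijective.1 h).2 w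
  have hv0 : (v : Lp ℂ 2 μI) ≠ 0 := by
    intro hv0
    rw [Submodule.coe_eq_zero.1 hv0, map_zero] at hv
    exact orthonormal_expLp.ne_zero (-1) (congrArg Subtype.val hv.symm)
  have hconst := ae_mul_norm_sq_eq_inner_toeplitz (hr := hr) (v := v) fun n hn => by
    rw [hv, ← inner_conj_symm, inner_expLp_modulation,
      mem_negFreq.1 v.2 _ (by lia), map_zero]
  have hpos : ∀ᵐ x ∂μI, 0 < ‖(v : Lp ℂ 2 μI) x‖ ^ 2 := by
    filter_upwards [ae_ne_zero_of_mem_negFreq v.2 hv0] with x hx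
    positivity
  have hκ : ∀ᵐ x ∂μI, r x * ‖(v : Lp ℂ 2 μI) x‖ ^ 2 = (inner ℂ v (toeplitz hr v)).re :=
    hconst.mono fun x hx => congrArg Complex.re hx
  rcases le_total 0 (inner ℂ v (toeplitz hr v)).re with hsign | hsign
  · left
    filter_upwards [hκ, hpos] with x hx hvx
    exact nonneg_of_mul_nonneg_left (hx ▸ hsign) hvx
  · right
    filter_upwards [hκ, hpos] with x hx hvx
    exact nonpos_of_mul_nonpos_left (hx ▸ hsign) hvx

theorem isUnit_toeplitz_of_ae_le {c : ℝ} (hc : 0 < c) (h : ∀ᵐ x ∂μI, c ≤ r x) :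
    IsUnit (toeplitz hr) := by
  refine ContinuousLinearMap.isUnit_of_forall_le_norm_inner_map _ (c := ⟨c, hc.le⟩) hc fun v => ?_
  rw [norm_inner_symm, inner_toeplitz_right, mul_comm]
  exact le_norm_inner_mulReal hr h v

end Toeplitz

section HartmanWintner

instance : NeZero μI := ⟨by norm_num [Measure.restrict_eq_zero]⟩

theorem isBoundedUnder_le_of_memLp_top {α : Type*} [MeasurableSpace α] {μ : Measure α} {r : α → ℝ}
    (hr : MemLp r ∞ μ) : Filter.IsBoundedUnder (· ≤ ·) (ae μ) r :=
  Filter.isBoundedUnder_of_eventually_le ((ae_le_lpNorm_exponent_top hr).mono fun _ =>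
    (le_abs_self _).trans)

theorem isBoundedUnder_ge_of_memLp_top {α : Type*} [MeasurableSpace α] {μ : Measure α} {r : α → ℝ}
    (hr : MemLp r ∞ μ) : Filter.IsBoundedUnder (· ≥ ·) (ae μ) r :=
  Filter.isBoundedUnder_of_eventually_ge ((ae_le_lpNorm_exponent_top hr).mono fun _ =>
    neg_le_of_abs_le)

variable {r : ℝ → ℝ} (hr : MemLp r ∞ μI)

theorem spectrum_toeplitz_subset :
    spectrum ℝ (toeplitz hr) ⊆ Set.Icc (essInf r μI) (essSup r μI) := by
  intro t ht
  rw [spectrum.mem_iff, ← toeplitz_const] at ht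
  by_contra hmem
  rw [Set.mem_Icc, not_and_or, not_le, not_le] at hmem
  rcases hmem with hlt | hlt
  · rw [← IsUnit.sub_iff, ← toeplitz_sub] at ht
    refine ht (isUnit_toeplitz_of_ae_le (sub_pos.2 hlt) ?_)
    filter_upwards [ae_essInf_le (isBoundedUnder_ge_of_memLp_top hr)] with x hx
    exact sub_le_sub_right hx t
  · rw [← toeplitz_sub] at ht
    refine ht (isUnit_toeplitz_of_ae_le (sub_pos.2 hlt) ?_)
    filter_upwards [ae_le_essSup (isBoundedUnder_le_of_memLp_top hr)] with x hx
    exact sub_le_sub_left hx t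

theorem Ioo_subset_spectrum_toeplitz :
    Set.Ioo (essInf r μI) (essSup r μI) ⊆ spectrum ℝ (toeplitz hr) := by
  rintro t ⟨hinf, hsup⟩
  rw [spectrum.mem_iff, ← toeplitz_const, ← IsUnit.sub_iff, ← toeplitz_sub]
  intro hunit
  have hle := isBoundedUnder_le_of_memLp_top hr
  have hge := isBoundedUnder_ge_of_memLp_top hr
  rcases ae_nonneg_or_ae_nonpos_of_isUnit_toeplitz hunit with h | h
  · exact hinf.not_ge (le_essInf_of_ae_le t (h.mono fun _ => sub_nonneg.1) hle.isCoboundedUnder_ge)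
  · exact hsup.not_ge (essSup_le_of_ae_le t (h.mono fun _ => sub_nonpos.1) hge.isCoboundedUnder_le)

theorem spectrum_toeplitz : spectrum ℝ (toeplitz hr) = Set.Icc (essInf r μI) (essSup r μI) :=
  spectrum_eq_Icc_of_Ioo_subset (isSelfAdjoint_toeplitz hr) (Ioo_subset_spectrum_toeplitz hr)
    (spectrum_toeplitz_subset hr)

end HartmanWintner

section System

variable {g : ℝ → ℝ} (hg : MemLp g ∞ μI)

theorem system_eq_blockOp_expBasis :
    system (fun x => (g x : ℂ)) (memLp_ofReal hg) =
      fun n => blockOp negFreq (mulReal hg) (expBasis n) := by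
  ext1 n
  rw [expBasis_apply, system]
  split_ifs with hn
  · rw [blockOp_apply_of_mem_orthogonal (expLp_mem_orthogonal_negFreq hn), expLp]
  · rw [blockOp_apply_of_mem (expLp_mem_negFreq (not_le.1 hn))]
    ext1
    filter_upwards [coeFn_mulOp (hg.ofReal (K := ℂ)) (expLp n), coeFn_expLp n,
      MemLp.coeFn_toLp (memLp_mul_e (memLp_ofReal hg) n)] with x hmul hexp hsys
    rw [hmul, hexp, hsys]
    rfl

theorem isUnit_toeplitz_of_isFrame_system
    (h : IsFrame (system (fun x => (g x : ℂ)) (memLp_ofReal hg))) : IsUnit (toeplitz hg) :=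
  isUnit_compression_of_isFrame_blockOp expBasis (isSelfAdjoint_mulReal hg)
    (system_eq_blockOp_expBasis hg ▸ h)

theorem isRieszBasis_system_of_isUnit_toeplitz (h : IsUnit (toeplitz hg)) :
    IsRieszBasis (system (fun x => (g x : ℂ)) (memLp_ofReal hg)) := by
  rw [system_eq_blockOp_expBasis hg]
  exact isRieszBasis_blockOp_of_isUnit_compression expBasis h

theorem isCompleteSystem_system (hg0 : ¬ g =ᵐ[μI] 0) :
    IsCompleteSystem (system (fun x => (g x : ℂ)) (memLp_ofReal hg)) := by
  intro f hf
  have hmem : f ∈ negFreq := mem_negFreq.2 fun n hn => by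
    simpa only [system, if_pos hn, expLp] using hf n
  have hadj : (blockOp negFreq (mulReal hg)).adjoint f = 0 := by
    rw [system_eq_blockOp_expBasis hg] at hf
    exact adjoint_eq_zero_of_inner_map_eq_zero expBasis hf
  have hT : toeplitz hg ⟨f, hmem⟩ = 0 := by
    rw [toeplitz, ← (isSelfAdjoint_mulReal hg).adjoint_eq, ← Submodule.coe_eq_zero]
    exact (adjoint_blockOp_coe ⟨f, hmem⟩).symm.trans hadj
  exact congrArg Subtype.val (toeplitz_injective hg0 (hT.trans (map_zero _).symm))

end System

end WindowedExp

end

theorem mainTheorem3 (g : ℝ → ℝ) (hg : MemLp g ∞ WindowedExp.μI)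
    (hg0 : ¬ g =ᵐ[WindowedExp.μI] 0) :
    WindowedExp.IsCompleteSystem
      (WindowedExp.system (fun x => (g x : ℂ)) (WindowedExp.memLp_ofReal hg)) ∧
    List.TFAE [
      WindowedExp.IsRieszBasis
        (WindowedExp.system (fun x => (g x : ℂ)) (WindowedExp.memLp_ofReal hg)),
      WindowedExp.IsFrame
        (WindowedExp.system (fun x => (g x : ℂ)) (WindowedExp.memLp_ofReal hg)),
      (0 : ℝ) ∉ Set.Icc (essInf g WindowedExp.μI) (essSup g WindowedExp.μI)] := by
  open WindowedExp in
  refine ⟨isCompleteSystem_system hg hg0, ?_⟩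
  rw [← spectrum_toeplitz hg, spectrum.zero_notMem_iff]
  tfae_have 1 → 2 := And.left
  tfae_have 2 → 3 := isUnit_toeplitz_of_isFrame_system hg
  tfae_have 3 → 1 := isRieszBasis_system_of_isUnit_toeplitz hg
  tfae_finish
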